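/- Let $G$ be a countably infinite bounded Abelian group, that is, $NG=0$ for some integer $N\ge 1$. Recall that, by Prüfer's theorem, such a $G$ has the form $$G\cong\bigoplus_{p\in M}\ \bigoplus_{i=1}^{n_p}\mathbb{Z}(p^i)^{(k_{i,p})},$$ where $M$ is a finite set of primes, $n_p\ge 1$, $\mathbb{Z}(p^i)$ is the cyclic group of order $p^i$, the $k_{i,p}$ are cardinals, $A^{(k)}$ denotes the direct sum of $k$ copies of $A$, and $k_{n_p,p}\neq 0$ for every $p\in M$. The cardinals $k_{n_p,p}$, $p\in M$, are the leading Ulm–Kaplansky invariants of $G$. A topological Abelian group $X$ is called minimally almost periodic (MinAP) if its von Neumann radical $\bigcap_{\chi}\ker\chi$, the intersection being over all continuous characters $\chi:X\to\mathbb{T}$, is equal to $X$. The group $G$ admits a Hausdorff MinAP group topology if and only if all its leading Ulm–Kaplansky invariants are infinite. In that case, there is a Hausdorff MinAP group topology on $G$ that is complete. -/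

import Mathlib

open scoped DirectSum

universe u

/-- The von Neumann radical of an (additively written) topological Abelian group `X`: the
intersection of the kernels of all continuous characters `X → 𝕋`. -/
noncomputable def vonNeumannRadical (X : Type u) [AddCommGroup X] [TopologicalSpace X] :
    AddSubgroup X :=
  ⨅ χ : {χ : AddChar X Circle // Continuous χ}, χ.1.toAddMonoidHom.ker

/-- `X` is minimally almost periodic (MinAP): its von Neumann radical is all of `X`. -/
def IsMinAP (X : Type u) [AddCommGroup X] [TopologicalSpace X] : Prop :=
  vonNeumannRadical X = ⊤

/-- Completeness of a topological Abelian group with respect to its group uniformity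
(left and right uniformities coincide, since the group is commutative). -/
def IsCompleteGroup (X : Type u) [AddCommGroup X] [TopologicalSpace X]
    [IsTopologicalAddGroup X] : Prop :=
  @CompleteSpace X (IsTopologicalAddGroup.rightUniformSpace X)

/-- A decomposition
`G ≃ ⨁_{p ∈ M} ⨁_{i = 1}^{n_p} ℤ(p^i)^{(k_{i,p})}`
of an Abelian group `G`, with `M` a finite set of primes and cardinals `k_{i,p}`; as usual,
`n_p ≥ 1` is the largest exponent `i` that occurs for `p`, so that `k_{n_p,p} ≠ 0`. -/
structure CyclicDecomposition (G : Type u) [AddCommGroup G] where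
  /-- the finite set of primes -/
  M : Finset ℕ
  prime_of_mem : ∀ p ∈ M, p.Prime
  /-- the largest exponent `n p` that occurs for the prime `p` -/
  n : ℕ → ℕ
  one_le_n : ∀ p ∈ M, 1 ≤ n p
  /-- the multiplicity `k i p` of the cyclic group of order `p ^ i` -/
  k : ℕ → ℕ → Cardinal.{u}
  k_ne_zero : ∀ p ∈ M, k (n p) p ≠ 0
  /-- the isomorphism; `κ →₀ A` is the direct sum of copies of `A` indexed by `κ` -/
  iso : G ≃+ ⨁ p : M, ⨁ i : Finset.Icc 1 (n p),
    ((k (i : ℕ) (p : ℕ)).out →₀ ZMod ((p : ℕ) ^ (i : ℕ)))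

/-- `c` is a leading Ulm–Kaplansky invariant of the (bounded) Abelian group `G`: it is one of
the cardinals `k_{n_p,p}`, `p ∈ M`, of a decomposition of `G` as above. -/
def IsLeadingUlmKaplanskyInvariant (G : Type u) [AddCommGroup G] (c : Cardinal.{u}) : Prop :=
  ∃ D : CyclicDecomposition G, ∃ p ∈ D.M, c = D.k (D.n p) p

/-! Sufficiency. For a decreasing chain of symmetric sets `A m` containing zero, the sets `sumSet A
φ` form a basis at zero of a group topology. It is MinAP if every `A m` generates `G`, since a
continuous character takes finitely many values and so is trivial on some `A m`. It is complete if
`A 0` generates `G` and each `A 0 \ A m` is finite, since `G` is then the union of the compact sets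
`k • A 0` and a diagonal argument applies. The chain consists of the signed tails of two sequences:
a sequence `e` of elements dual to coordinates `π j`, available because the leading invariants are
infinite, and `g n` plus the sum of `e` over the block `[2 ^ n, 2 ^ (n + 1))`, where `g` hits every
element infinitely often. Each tail generates `G`. The topology is Hausdorff because cancelling a
block takes `2 ^ n` terms, while a sum from a small neighbourhood has too few terms of index below
`2 ^ (n + 1)` (`IsCoordinateSystem.notMem_sumSet`).

Necessity. If a leading invariant is finite, some multiple `m • G` is finite and nonzero, and its
characters pull back to continuous characters of `G`.

Prüfer's theorem is proved as well: sufficiency needs at least one decomposition to draw coordinates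
from. -/

open Filter Topology
open scoped Pointwise

/-! ### The group topology defined by a shrinking chain -/

/-- The set of all finite sums `∑ f i` with `f i ∈ A (φ i)`. -/
def sumSet {G : Type*} [AddCommMonoid G] (A : ℕ → Set G) (φ : ℕ → ℕ) : Set G :=
  {x | ∃ (k : ℕ) (f : ℕ → G), (∀ i, f i ∈ A (φ i)) ∧ ∑ i ∈ Finset.range k, f i = x}

/-- A decreasing sequence of symmetric sets containing zero. -/
structure IsSymmChain {G : Type*} [AddCommGroup G] (A : ℕ → Set G) : Prop where
  anti : Antitone A
  zero_mem : ∀ m, (0 : G) ∈ A m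
  neg_mem : ∀ m, ∀ x ∈ A m, -x ∈ A m

namespace IsSymmChain

variable {G : Type*} [AddCommGroup G] {A : ℕ → Set G}

theorem sumSet_mono (hA : IsSymmChain A) {φ ψ : ℕ → ℕ} (h : φ ≤ ψ) :
    sumSet A ψ ⊆ sumSet A φ := by
  rintro x ⟨k, f, hf, rfl⟩
  exact ⟨k, f, fun i => hA.anti (h i) (hf i), rfl⟩

theorem zero_mem_sumSet (hA : IsSymmChain A) (φ : ℕ → ℕ) : (0 : G) ∈ sumSet A φ :=
  ⟨0, 0, fun _ => hA.zero_mem _, by simp⟩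

theorem subset_sumSet (hA : IsSymmChain A) (φ : ℕ → ℕ) : A (φ 0) ⊆ sumSet A φ := by
  intro x hx
  refine ⟨1, fun i => if i = 0 then x else 0, fun i => ?_, by simp⟩
  dsimp only
  split_ifs with h
  · exact h ▸ hx
  · exact hA.zero_mem _

theorem exists_sum_eq (hA : IsSymmChain A) {φ : ℕ → ℕ} {x : G} (hx : x ∈ sumSet A φ) :
    ∃ k₀, ∀ k, k₀ ≤ k → ∃ f : ℕ → G, (∀ i, f i ∈ A (φ i)) ∧ ∑ i ∈ Finset.range k, f i = x := by
  obtain ⟨k₀, f, hf, rfl⟩ := hx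
  refine ⟨k₀, fun k hk => ⟨fun i => if i < k₀ then f i else 0, fun i => ?_, ?_⟩⟩
  · dsimp only
    split_ifs
    · exact hf i
    · exact hA.zero_mem _
  · rw [← Finset.sum_filter]
    congr 1
    ext i
    simp only [Finset.mem_filter, Finset.mem_range]
    omega

/-- Interleave the two sums, one at the even and the other at the odd places. -/
theorem add_sumSet_subset (hA : IsSymmChain A) (φ : ℕ → ℕ) :
    sumSet A (fun i => max (φ (2 * i)) (φ (2 * i + 1))) +
      sumSet A (fun i => max (φ (2 * i)) (φ (2 * i + 1))) ⊆ sumSet A φ := by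
  rintro _ ⟨x, hx, y, hy, rfl⟩
  obtain ⟨k, hk⟩ := hA.exists_sum_eq hx
  obtain ⟨l, hl⟩ := hA.exists_sum_eq hy
  obtain ⟨f, hf, rfl⟩ := hk (max k l) (le_max_left _ _)
  obtain ⟨g, hg, rfl⟩ := hl (max k l) (le_max_right _ _)
  refine ⟨2 * max k l, fun i => if i % 2 = 0 then f (i / 2) else g (i / 2), fun i => ?_, ?_⟩
  · dsimp only
    split_ifs with h
    · have := hA.anti (le_max_left _ _) (hf (i / 2))
      rwa [show 2 * (i / 2) = i by omega] at this
    · have := hA.anti (le_max_right _ _) (hg (i / 2))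
      rwa [show 2 * (i / 2) + 1 = i by omega] at this
  · generalize max k l = m
    dsimp only
    rw [← Finset.sum_add_distrib]
    induction m with
    | zero => simp
    | succ m ih =>
      rw [show 2 * (m + 1) = 2 * m + 1 + 1 by ring, Finset.sum_range_succ, Finset.sum_range_succ,
        ih, Finset.sum_range_succ, add_assoc]
      simp [show (2 * m + 1) % 2 = 1 by omega, show (2 * m + 1) / 2 = m by omega]

theorem neg_mem_sumSet (hA : IsSymmChain A) {φ : ℕ → ℕ} {x : G} (hx : x ∈ sumSet A φ) :
    -x ∈ sumSet A φ := by
  obtain ⟨k, f, hf, rfl⟩ := hx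
  exact ⟨k, fun i => -f i, fun i => hA.neg_mem _ _ (hf i), by simp⟩

theorem sumSet_subset_nsmul_add (hA : IsSymmChain A) (φ : ℕ → ℕ) (n : ℕ) :
    sumSet A φ ⊆ n • A 0 + sumSet A (fun i => φ (n + i)) := by
  intro x hx
  obtain ⟨k, hk⟩ := hA.exists_sum_eq hx
  obtain ⟨f, hf, rfl⟩ := hk (n + k) (by omega)
  rw [Finset.sum_range_add]
  refine Set.add_mem_add ?_ ⟨k, fun i => f (n + i), fun i => hf _, rfl⟩
  clear hx hk
  induction n with
  | zero => simp
  | succ n ih =>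
    rw [Finset.sum_range_succ, succ_nsmul]
    exact Set.add_mem_add ih (hA.anti (Nat.zero_le _) (hf n))

/-- The sets `sumSet A φ` as a basis of neighbourhoods of zero. -/
@[reducible]
def filterBasis (hA : IsSymmChain A) : AddGroupFilterBasis G :=
  addGroupFilterBasisOfComm (Set.range (sumSet A)) (Set.range_nonempty _)
    (by
      rintro _ _ ⟨φ, rfl⟩ ⟨ψ, rfl⟩
      exact ⟨_, ⟨φ ⊔ ψ, rfl⟩, Set.subset_inter (hA.sumSet_mono le_sup_left)
        (hA.sumSet_mono le_sup_right)⟩)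
    (by
      rintro _ ⟨φ, rfl⟩
      exact hA.zero_mem_sumSet φ)
    (by
      rintro _ ⟨φ, rfl⟩
      exact ⟨_, ⟨_, rfl⟩, hA.add_sumSet_subset φ⟩)
    (by
      rintro _ ⟨φ, rfl⟩
      exact ⟨_, ⟨φ, rfl⟩, fun x hx => hA.neg_mem_sumSet hx⟩)

/-- The finest group topology in which the sets `A m` shrink to zero. -/
abbrev topology (hA : IsSymmChain A) : TopologicalSpace G := hA.filterBasis.topology

theorem isTopologicalAddGroup (hA : IsSymmChain A) :
    @IsTopologicalAddGroup G hA.topology _ :=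
  hA.filterBasis.isTopologicalAddGroup

theorem mem_nhds_zero (hA : IsSymmChain A) {U : Set G} :
    U ∈ @nhds G hA.topology 0 ↔ ∃ φ, sumSet A φ ⊆ U := by
  rw [hA.filterBasis.nhds_zero_hasBasis.mem_iff]
  constructor
  · rintro ⟨_, ⟨φ, rfl⟩, h⟩
    exact ⟨φ, h⟩
  · rintro ⟨φ, h⟩
    exact ⟨_, ⟨φ, rfl⟩, h⟩

theorem t2Space (hA : IsSymmChain A) (h : ∀ g : G, g ≠ 0 → ∃ φ, g ∉ sumSet A φ) :
    @T2Space G hA.topology := by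
  let _ := hA.topology
  have := hA.isTopologicalAddGroup
  refine IsTopologicalAddGroup.t2Space_of_zero_sep fun g hg => ?_
  obtain ⟨φ, hφ⟩ := h g hg
  exact ⟨_, hA.mem_nhds_zero.2 ⟨φ, subset_rfl⟩, hφ⟩

/-- An ultrafilter on `A 0` containing every `A m` converges to zero; any other one contains a
finite set `A 0 \ A m`, hence is principal. -/
theorem isCompact (hA : IsSymmChain A) (hfin : ∀ m, (A 0 \ A m).Finite) :
    @IsCompact G hA.topology (A 0) := by
  let _ := hA.topology
  rw [isCompact_iff_ultrafilter_le_nhds']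
  intro f hf
  by_cases h : ∀ m, A m ∈ f
  · refine ⟨0, hA.zero_mem 0, fun U hU => ?_⟩
    obtain ⟨φ, hφ⟩ := hA.mem_nhds_zero.1 hU
    exact Filter.mem_of_superset (h (φ 0)) ((hA.subset_sumSet φ).trans hφ)
  · push Not at h
    obtain ⟨m, hm⟩ := h
    have hd : A 0 \ A m ∈ f := Filter.inter_mem hf (Ultrafilter.compl_mem_iff_notMem.2 hm)
    obtain ⟨x, hx, hfx⟩ := Ultrafilter.eq_pure_of_finite_mem (hfin m) hd
    exact ⟨x, hx.1, hfx ▸ pure_le_nhds x⟩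

end IsSymmChain

/-! ### Completeness -/

/-- If no point of `K` were a cluster point, continuity of addition would give each point a
neighbourhood `S` with some `S + U` missing some `F`; compactness makes `U` and `F` uniform over
`K`. -/
theorem exists_clusterPt_of_isCompact {G : Type*} [AddCommGroup G] [TopologicalSpace G]
    [IsTopologicalAddGroup G] {K : Set G} (hK : IsCompact K) {f : Filter G}
    (h : ∀ U ∈ 𝓝 (0 : G), ∀ F ∈ f, ((K + U) ∩ F).Nonempty) :
    ∃ x ∈ K, ClusterPt x f := by
  by_contra! hcon
  have key : ∃ U ∈ 𝓝 (0 : G), ∃ F ∈ f, (K + U) ∩ F = ∅ := by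
    refine hK.induction_on (p := fun S => ∃ U ∈ 𝓝 (0 : G), ∃ F ∈ f, (S + U) ∩ F = ∅)
      ?_ ?_ ?_ ?_
    · exact ⟨Set.univ, univ_mem, Set.univ, univ_mem, by simp⟩
    · rintro S T hST ⟨U, hU, F, hF, hd⟩
      exact ⟨U, hU, F, hF, Set.subset_empty_iff.1
        (hd ▸ Set.inter_subset_inter_left _ (Set.add_subset_add_right hST))⟩
    · rintro S T ⟨U, hU, F, hF, hd⟩ ⟨U', hU', F', hF', hd'⟩
      refine ⟨U ∩ U', inter_mem hU hU', F ∩ F', inter_mem hF hF', ?_⟩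
      rw [Set.eq_empty_iff_forall_notMem] at hd hd' ⊢
      rintro _ ⟨⟨s, hs | hs, v, hv, rfl⟩, hy⟩
      · exact hd _ ⟨Set.add_mem_add hs hv.1, hy.1⟩
      · exact hd' _ ⟨Set.add_mem_add hs hv.2, hy.2⟩
    · intro x hx
      have hx' := hcon x hx
      rw [clusterPt_iff_nonempty] at hx'
      push Not at hx'
      obtain ⟨V, hV, F, hF, hd⟩ := hx'
      have hc : Tendsto (fun q : G × G => q.1 + q.2) (𝓝 x ×ˢ 𝓝 0) (𝓝 x) := by
        have := (continuous_add (M := G)).tendsto (x, 0)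
        rwa [add_zero, nhds_prod_eq] at this
      obtain ⟨S, hS, U, hU, hSU⟩ := Filter.mem_prod_iff.1 (hc hV)
      refine ⟨S, mem_nhdsWithin_of_mem_nhds hS, U, hU, F, hF, ?_⟩
      rw [Set.eq_empty_iff_forall_notMem] at hd ⊢
      rintro _ ⟨⟨s, hs, v, hv, rfl⟩, hy⟩
      exact hd _ ⟨hSU (Set.mk_mem_prod hs hv), hy⟩
  obtain ⟨U, hU, F, hF, hd⟩ := key
  exact (h U hU F hF).ne_empty hd

theorem isCompact_nsmul {G : Type*} [AddCommGroup G] [TopologicalSpace G]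
    [IsTopologicalAddGroup G] {K : Set G} (hK : IsCompact K) (n : ℕ) : IsCompact (n • K) := by
  induction n with
  | zero => simp
  | succ n ih => rw [succ_nsmul]; exact ih.add hK

theorem IsSymmChain.neg_mem_nsmul {G : Type*} [AddCommGroup G] {A : ℕ → Set G}
    (hA : IsSymmChain A) {k : ℕ} {x : G} (hx : x ∈ k • A 0) : -x ∈ k • A 0 := by
  induction k generalizing x with
  | zero => simpa using hx
  | succ k ih =>
    rw [succ_nsmul] at hx ⊢
    obtain ⟨y, hy, z, hz, rfl⟩ := hx
    rw [neg_add]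
    exact Set.add_mem_add (ih hy) (hA.neg_mem 0 z hz)

theorem IsSymmChain.exists_mem_nsmul {G : Type*} [AddCommGroup G] {A : ℕ → Set G}
    (hA : IsSymmChain A) (hgen : AddSubgroup.closure (A 0) = ⊤) (x : G) : ∃ k : ℕ, x ∈ k • A 0 := by
  have hx : x ∈ AddSubgroup.closure (A 0) := hgen ▸ AddSubgroup.mem_top x
  induction hx using AddSubgroup.closure_induction with
  | mem x hx => exact ⟨1, by simpa using hx⟩
  | zero => exact ⟨0, by simp⟩
  | add x y _ _ hx hy =>
    obtain ⟨k, hk⟩ := hx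
    obtain ⟨l, hl⟩ := hy
    exact ⟨k + l, by rw [add_nsmul]; exact Set.add_mem_add hk hl⟩
  | neg x _ hx =>
    obtain ⟨k, hk⟩ := hx
    exact ⟨k, hA.neg_mem_nsmul hk⟩

/-- It suffices that a Cauchy filter meets every `k • A 0 + U` for one fixed `k`, for then it has a
cluster point in a compact set. Otherwise each `k` has a bad pair `U k`, `F k`, and one `ψ`
dominating all these neighbourhoods gives a contradiction. -/
theorem IsSymmChain.isCompleteGroup {G : Type u} [AddCommGroup G] {A : ℕ → Set G}
    (hA : IsSymmChain A) (hfin : ∀ m, (A 0 \ A m).Finite)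
    (hgen : AddSubgroup.closure (A 0) = ⊤) :
    @IsCompleteGroup G _ hA.topology hA.isTopologicalAddGroup := by
  let _ := hA.topology
  have := hA.isTopologicalAddGroup
  let _ := IsTopologicalAddGroup.rightUniformSpace G
  refine ⟨fun {f} hf => ?_⟩
  have hcau : ∀ U ∈ 𝓝 (0 : G), ∃ F ∈ f, ∀ x ∈ F, ∀ y ∈ F, y - x ∈ U := by
    intro U hU
    have hent : {q : G × G | q.2 - q.1 ∈ U} ∈ uniformity G := by
      rw [uniformity_eq_comap_nhds_zero' G]
      exact ⟨U, hU, fun q hq => by simpa [sub_eq_add_neg] using hq⟩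
    obtain ⟨F, hF, hFU⟩ := (cauchy_iff.1 hf).2 _ hent
    exact ⟨F, hF, fun x hx y hy => hFU (Set.mk_mem_prod hx hy)⟩
  suffices h : ∃ k : ℕ, ∀ U ∈ 𝓝 (0 : G), ∀ F ∈ f, ((k • A 0 + U) ∩ F).Nonempty by
    obtain ⟨k, hk⟩ := h
    obtain ⟨x, -, hx⟩ := exists_clusterPt_of_isCompact (isCompact_nsmul (hA.isCompact hfin) k) hk
    exact ⟨x, le_nhds_of_cauchy_adhp hf hx⟩
  by_contra! hcon
  choose U hU F hF hd using hcon
  have hφ : ∀ k, ∃ φ, sumSet A φ ⊆ U k := fun k => hA.mem_nhds_zero.1 (hU k)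
  choose φ hφ using hφ
  -- The choice gives `ψ (k + i) ≥ φ (2 * k) i` for all `k` and `i`: after its first `k` terms, a
  -- sum from `sumSet A ψ` lies in `U (2 * k)`.
  let ψ : ℕ → ℕ := fun i => (Finset.range (i + 1)).sup fun k => φ (2 * k) (i - k)
  obtain ⟨E, hE, hEψ⟩ := hcau _ (hA.mem_nhds_zero.2 ⟨ψ, subset_rfl⟩)
  have hfne := hf.1
  obtain ⟨x, hx⟩ := hfne.nonempty_of_mem hE
  obtain ⟨k, hk⟩ := hA.exists_mem_nsmul hgen x
  -- The index is `2 * k` because `x` uses `k` summands from `A 0` and the head of `y - x` uses `k`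
  -- more.
  obtain ⟨y, hyE, hyF⟩ := hfne.nonempty_of_mem (inter_mem hE (hF (2 * k)))
  refine (Set.eq_empty_iff_forall_notMem.1 (hd (2 * k))) y ⟨?_, hyF⟩
  obtain ⟨a, ha, b, hb, hab⟩ := hA.sumSet_subset_nsmul_add ψ k (hEψ x hx y hyE)
  have hb' : b ∈ U (2 * k) := by
    refine hφ (2 * k) (hA.sumSet_mono (fun i => ?_) hb)
    have := Finset.le_sup (f := fun j => φ (2 * j) (k + i - j))
      (show k ∈ Finset.range (k + i + 1) by simp)
    simpa using this
  have hy : y = (x + a) + b := by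
    simp only at hab
    rw [add_assoc, hab]; abel
  rw [hy]
  refine Set.add_mem_add ?_ hb'
  rw [two_mul, add_nsmul]
  exact Set.add_mem_add hk ha

/-! ### Minimal almost periodicity -/

theorem finite_setOf_pow_eq_one (N : ℕ) (hN : 0 < N) : {z : Circle | z ^ N = 1}.Finite := by
  refine Set.Finite.of_finite_image (f := ((↑) : Circle → ℂ)) ?_ Subtype.val_injective.injOn
  refine (Polynomial.nthRootsFinset N (1 : ℂ)).finite_toSet.subset ?_
  rintro _ ⟨z, hz, rfl⟩
  rw [Finset.mem_coe, Polynomial.mem_nthRootsFinset hN]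
  exact_mod_cast congrArg ((↑) : Circle → ℂ) hz

/-- Character values are `N`-th roots of unity, so those other than 1 form a finite closed set.
Hence the kernel of a continuous character is a neighbourhood of zero; it contains some `A m`, which
generates `G`. -/
theorem IsSymmChain.isMinAP {G : Type u} [AddCommGroup G] {A : ℕ → Set G}
    (hA : IsSymmChain A) (hgen : ∀ m, AddSubgroup.closure (A m) = ⊤)
    (hG : AddMonoid.ExponentExists G) : @IsMinAP G _ hA.topology := by
  let _ := hA.topology
  obtain ⟨N, hN, hNG⟩ := hG
  refine eq_top_iff.2 (le_iInf ?_)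
  rintro ⟨χ, hχ⟩
  have hpow : ∀ x, χ x ^ N = 1 := fun x => by
    rw [← AddChar.map_nsmul_eq_pow, hNG, AddChar.map_zero_eq_one]
  have hcl : IsClosed {z : Circle | z ^ N = 1 ∧ z ≠ 1} :=
    ((finite_setOf_pow_eq_one N hN).subset fun z hz => hz.1).isClosed
  have hU : χ ⁻¹' {z : Circle | z ^ N = 1 ∧ z ≠ 1}ᶜ ∈ 𝓝 (0 : G) :=
    (hcl.isOpen_compl.preimage hχ).mem_nhds (by simp)
  obtain ⟨φ, hφ⟩ := hA.mem_nhds_zero.1 hU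
  rw [← hgen (φ 0), AddSubgroup.closure_le]
  intro x hx
  have := hφ (hA.subset_sumSet φ hx)
  have hx1 : χ x = 1 := by
    by_contra hne
    exact this ⟨hpow x, hne⟩
  exact hx1

/-! ### Chains of tails of two sequences -/

/-- The elements `±v j`, `±w j` with `j ≥ m`, together with zero. -/
def signedTail {G : Type*} [AddCommGroup G] (v w : ℕ → G) (m : ℕ) : Set G :=
  {x | ∃ (ε : ℤ) (j : ℕ), ε ∈ Finset.Icc (-1 : ℤ) 1 ∧ m ≤ j ∧ (x = ε • v j ∨ x = ε • w j)}

section signedTail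

variable {G : Type*} [AddCommGroup G] (v w : ℕ → G)

theorem isSymmChain_signedTail : IsSymmChain (signedTail v w) where
  anti := by
    rintro m n hmn x ⟨ε, j, hε, hj, hx⟩
    exact ⟨ε, j, hε, hmn.trans hj, hx⟩
  zero_mem m := ⟨0, m, by simp, le_rfl, by simp⟩
  neg_mem := by
    rintro m x ⟨ε, j, hε, hj, hx⟩
    refine ⟨-ε, j, ?_, hj, ?_⟩
    · rw [Finset.mem_Icc] at hε ⊢
      omega
    · rcases hx with rfl | rfl <;> simp

theorem finite_signedTail_diff (m : ℕ) : (signedTail v w 0 \ signedTail v w m).Finite := by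
  refine (((Finset.Icc (-1 : ℤ) 1 ×ˢ Finset.range m).finite_toSet.image
    fun q => q.1 • v q.2).union ((Finset.Icc (-1 : ℤ) 1 ×ˢ Finset.range m).finite_toSet.image
    fun q => q.1 • w q.2)).subset ?_
  rintro x ⟨⟨ε, j, hε, -, hx⟩, hxm⟩
  have hj : j < m := by
    by_contra hj
    exact hxm ⟨ε, j, hε, not_lt.1 hj, hx⟩
  have hmem : (ε, j) ∈ ((Finset.Icc (-1 : ℤ) 1 ×ˢ Finset.range m : Finset (ℤ × ℕ)) :
      Set (ℤ × ℕ)) :=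
    Finset.mem_coe.2 (Finset.mem_product.2 ⟨hε, Finset.mem_range.2 hj⟩)
  rcases hx with rfl | rfl
  · exact Or.inl ⟨_, hmem, rfl⟩
  · exact Or.inr ⟨_, hmem, rfl⟩

theorem left_mem_signedTail {m j : ℕ} (h : m ≤ j) : v j ∈ signedTail v w m :=
  ⟨1, j, by simp, h, by simp⟩

theorem right_mem_signedTail {m j : ℕ} (h : m ≤ j) : w j ∈ signedTail v w m :=
  ⟨1, j, by simp, h, by simp⟩

theorem exists_coeff_of_mem_sumSet {φ : ℕ → ℕ} {x : G} (hx : x ∈ sumSet (signedTail v w) φ) :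
    ∃ (ε : ℕ → ℤ) (J : ℕ → ℕ) (I I' : Finset ℕ), (∀ i, φ i ≤ J i) ∧
      x = ∑ i ∈ I, ε i • v (J i) + ∑ i ∈ I', ε i • w (J i) := by
  classical
  obtain ⟨k, f, hf, rfl⟩ := hx
  choose ε J hε hJ h using hf
  refine ⟨ε, J, (Finset.range k).filter fun i => f i = ε i • v (J i),
    (Finset.range k).filter fun i => ¬ f i = ε i • v (J i), hJ, ?_⟩
  rw [← Finset.sum_filter_add_sum_filter_not _ fun i => f i = ε i • v (J i)]
  congr 1
  · exact Finset.sum_congr rfl fun i hi => (Finset.mem_filter.1 hi).2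
  · exact Finset.sum_congr rfl fun i hi => (h i).resolve_left (Finset.mem_filter.1 hi).2

theorem sum_zsmul_comp_eq_sum_range (ε : ℕ → ℤ) (J : ℕ → ℕ) (I : Finset ℕ) {T : ℕ}
    (hT : ∀ i ∈ I, J i < T) :
    ∑ i ∈ I, ε i • v (J i) =
      ∑ n ∈ Finset.range T, (∑ i ∈ I with J i = n, ε i) • v n := by
  rw [← Finset.sum_fiberwise_of_maps_to (t := Finset.range T) (g := J)
    fun i hi => Finset.mem_range.2 (hT i hi)]
  refine Finset.sum_congr rfl fun n _ => ?_
  rw [Finset.sum_smul]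
  exact Finset.sum_congr rfl fun i hi => by rw [(Finset.mem_filter.1 hi).2]

end signedTail

/-! ### Coordinate systems and the Hausdorff property -/

/-- Coordinate functionals `π j : G →+ R` with a dual sequence `e`, where the order of `r` is a
multiple of the exponent of `G`. -/
structure IsCoordinateSystem {G R : Type*} [AddCommGroup G] [AddCommGroup R]
    (π : ℕ → G →+ R) (e : ℕ → G) (r : R) : Prop where
  eventually_zero : ∀ g, ∃ t, ∀ j, t ≤ j → π j g = 0
  apply_self : ∀ j, π j (e j) = r
  apply_of_ne : ∀ i j, i ≠ j → π i (e j) = 0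
  annihilates : ∀ z : ℤ, z • r = 0 → ∀ g : G, z • g = 0

namespace IsCoordinateSystem

variable {G R : Type*} [AddCommGroup G] [AddCommGroup R] {π : ℕ → G →+ R} {e : ℕ → G} {r : R}

/-- Pairing repeats every element infinitely often; a term whose coordinates do not yet vanish from
`2 ^ n` on is replaced by zero, which spoils only finitely many occurrences of each element. -/
theorem exists_enumeration [Countable G] (h : IsCoordinateSystem π e r) :
    ∃ g : ℕ → G, (∀ x m, ∃ n, m ≤ n ∧ g n = x) ∧ ∀ n j, 2 ^ n ≤ j → π j (g n) = 0 := by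
  classical
  obtain ⟨f, hf⟩ := exists_surjective_nat G
  refine ⟨fun n => if ∀ j, 2 ^ n ≤ j → π j (f n.unpair.1) = 0 then f n.unpair.1 else 0,
    fun x m => ?_, fun n j hj => ?_⟩
  · obtain ⟨a, rfl⟩ := hf x
    obtain ⟨t, ht⟩ := h.eventually_zero (f a)
    have hle : max m t ≤ Nat.pair a (max m t) := Nat.right_le_pair _ _
    refine ⟨Nat.pair a (max m t), (le_max_left _ _).trans hle, ?_⟩
    dsimp only
    rw [if_pos]
    · simp
    · intro j hj
      simp only [Nat.unpair_pair]
      exact ht j (((le_max_right _ _).trans hle).trans (Nat.lt_two_pow_self.le.trans hj))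
  · dsimp only
    split_ifs with hc
    · exact hc j hj
    · simp

/-- The sequence `g n` shifted by blocks of increasing length of the dual sequence. -/
def shifted (e g : ℕ → G) (n : ℕ) : G := g n + ∑ j ∈ Finset.Ico (2 ^ n) (2 ^ (n + 1)), e j

theorem closure_signedTail {g : ℕ → G} (hg : ∀ x m, ∃ n, m ≤ n ∧ g n = x) (m : ℕ) :
    AddSubgroup.closure (signedTail e (shifted e g) m) = ⊤ := by
  refine eq_top_iff.2 fun x _ => ?_
  obtain ⟨n, hn, rfl⟩ := hg x m
  have hx : g n = shifted e g n - ∑ j ∈ Finset.Ico (2 ^ n) (2 ^ (n + 1)), e j := by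
    simp [shifted]
  rw [hx]
  refine sub_mem (AddSubgroup.subset_closure (right_mem_signedTail _ _ hn))
    (sum_mem fun j hj => AddSubgroup.subset_closure (left_mem_signedTail _ _ ?_))
  exact hn.trans (Nat.lt_two_pow_self.le.trans (Finset.mem_Ico.1 hj).1)

theorem apply_sum_range (h : IsCoordinateSystem π e r) (c : ℕ → ℤ) {T j : ℕ} (hj : j < T) :
    π j (∑ n ∈ Finset.range T, c n • e n) = c j • r := by
  rw [map_sum, Finset.sum_eq_single j]
  · rw [map_zsmul, h.apply_self]
  · intro n _ hn
    rw [map_zsmul, h.apply_of_ne j n hn.symm, smul_zero]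
  · intro hn
    exact absurd (Finset.mem_range.2 hj) hn

theorem apply_shifted (h : IsCoordinateSystem π e r) {g : ℕ → G}
    (hg : ∀ n j, 2 ^ n ≤ j → π j (g n) = 0) {n j : ℕ} (hj : 2 ^ n ≤ j) (hj' : j < 2 ^ (n + 1)) :
    π j (shifted e g n) = r := by
  rw [shifted, map_add, hg n j hj, zero_add, map_sum, Finset.sum_eq_single j]
  · exact h.apply_self j
  · exact fun i _ hi => h.apply_of_ne j i hi.symm
  · exact fun hn => absurd (Finset.mem_Ico.2 ⟨hj, hj'⟩) hn

theorem apply_shifted_of_le (h : IsCoordinateSystem π e r) {g : ℕ → G}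
    (hg : ∀ n j, 2 ^ n ≤ j → π j (g n) = 0) {n j : ℕ} (hj : 2 ^ (n + 1) ≤ j) :
    π j (shifted e g n) = 0 := by
  rw [shifted, map_add, hg n j ((Nat.pow_le_pow_right two_pos n.le_succ).trans hj), zero_add,
    map_sum]
  refine Finset.sum_eq_zero fun i hi => h.apply_of_ne j i ?_
  have := (Finset.mem_Ico.1 hi).2
  omega

/-- Collect `x = ∑ c n • e n + ∑ ρ n • shifted e g n`. If every `ρ n` kills `r`, the second sum
vanishes and the coordinates force `x = 0`. Otherwise let `n` be the largest index with `ρ n • r ≠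
0`. On the block of `n` the second sum has coordinate `ρ n • r`, which the first must cancel, so all
`2 ^ n` indices of the block occur among the `J i`. -/
theorem notMem_sumSet (h : IsCoordinateSystem π e r) {g : ℕ → G}
    (hg : ∀ n j, 2 ^ n ≤ j → π j (g n) = 0) {x : G} {t : ℕ} (ht : ∀ j, t ≤ j → π j x = 0)
    (hx0 : x ≠ 0) :
    x ∉ sumSet (signedTail e (shifted e g)) fun i => 2 ^ (i + t + 1) := by
  classical
  intro hx
  obtain ⟨ε, J, I, I', hJ, hxe⟩ := exists_coeff_of_mem_sumSet _ _ hx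
  obtain ⟨T, hT⟩ : ∃ T, ∀ i ∈ I ∪ I', J i < T :=
    ⟨(I ∪ I').sup J + 1, fun i hi => Nat.lt_succ_of_le (Finset.le_sup hi)⟩
  rw [sum_zsmul_comp_eq_sum_range e ε J I fun i hi => hT i (Finset.mem_union_left _ hi),
    sum_zsmul_comp_eq_sum_range _ ε J I' fun i hi => hT i (Finset.mem_union_right _ hi)] at hxe
  set c : ℕ → ℤ := fun n => ∑ i ∈ I with J i = n, ε i with hc
  set ρ : ℕ → ℤ := fun n => ∑ i ∈ I' with J i = n, ε i with hρ
  have hJt : ∀ i, t + 1 < J i := fun i =>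
    lt_of_lt_of_le (lt_of_le_of_lt (by omega) Nat.lt_two_pow_self) (hJ i)
  have hcne : ∀ j, c j ≠ 0 → ∃ i, J i = j := fun j hj => by
    obtain ⟨i, hi, -⟩ := Finset.exists_ne_zero_of_sum_ne_zero hj
    exact ⟨i, (Finset.mem_filter.1 hi).2⟩
  have hρne : ∀ j, ρ j ≠ 0 → ∃ i, i ∈ I' ∧ J i = j := fun j hj => by
    obtain ⟨i, hi, -⟩ := Finset.exists_ne_zero_of_sum_ne_zero hj
    exact ⟨i, Finset.mem_filter.1 hi⟩
  by_cases hall : ∀ n, ρ n • r = 0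
  · have hxc : x = ∑ n ∈ Finset.range T, c n • e n := by
      rw [hxe, Finset.sum_eq_zero (s := Finset.range T) (f := fun n => ρ n • shifted e g n)
        fun n _ => h.annihilates _ (hall n) _, add_zero]
    refine hx0 (hxc.trans (Finset.sum_eq_zero fun j hj => h.annihilates _ ?_ _))
    rcases lt_or_ge j t with hjt | hjt
    · have : c j = 0 := by
        by_contra hne
        obtain ⟨i, rfl⟩ := hcne j hne
        have := hJt i
        omega
      rw [this, zero_smul]
    · rw [← h.apply_sum_range c (Finset.mem_range.1 hj), ← hxc, ht j hjt]
  · have hne : ((Finset.range T).filter fun n => ρ n • r ≠ 0).Nonempty := by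
      push Not at hall
      obtain ⟨n, hn⟩ := hall
      obtain ⟨i, hi, rfl⟩ := hρne n fun h0 => hn (by rw [h0, zero_smul])
      exact ⟨J i, Finset.mem_filter.2
        ⟨Finset.mem_range.2 (hT i (Finset.mem_union_right _ hi)), hn⟩⟩
    obtain ⟨n, hn, hmax⟩ := Finset.exists_max_image _ id hne
    rw [Finset.mem_filter, Finset.mem_range] at hn
    have hnt : t + 1 < n := by
      obtain ⟨i, -, rfl⟩ := hρne n fun h0 => hn.2 (by rw [h0, zero_smul])
      exact hJt i
    have hlarge : ∀ m, n < m → ρ m • shifted e g m = 0 := by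
      intro m hm
      refine h.annihilates _ (by_contra fun hne => ?_) _
      obtain ⟨i, hi, rfl⟩ := hρne m fun h0 => hne (by rw [h0, zero_smul])
      exact absurd (hmax (J i) (Finset.mem_filter.2
        ⟨Finset.mem_range.2 (hT i (Finset.mem_union_right _ hi)), hne⟩)) (not_le.2 hm)
    have hsub : Finset.Ico (2 ^ n) (2 ^ (n + 1)) ⊆ (Finset.range n).image J := by
      intro j hj
      rw [Finset.mem_Ico] at hj
      have hsh : π j (∑ m ∈ Finset.range T, ρ m • shifted e g m) = ρ n • r := by
        rw [map_sum, Finset.sum_eq_single n]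
        · rw [map_zsmul, h.apply_shifted hg hj.1 hj.2]
        · intro m _ hmn
          rcases lt_or_gt_of_ne hmn with hm | hm
          · rw [map_zsmul, h.apply_shifted_of_le hg
              ((Nat.pow_le_pow_right two_pos hm).trans hj.1), smul_zero]
          · rw [hlarge m hm, map_zero]
        · exact fun hnT => absurd (Finset.mem_range.2 hn.1) hnT
      have hjn : n < j := Nat.lt_two_pow_self.trans_le hj.1
      have hxj := congrArg (π j) hxe
      rw [ht j (by omega), map_add, hsh] at hxj
      have hcj : c j ≠ 0 := by
        intro h0
        rcases lt_or_ge j T with hjT | hjT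
        · rw [h.apply_sum_range c hjT, h0, zero_smul, zero_add] at hxj
          exact hn.2 hxj.symm
        · have : π j (∑ m ∈ Finset.range T, c m • e m) = 0 := by
            rw [map_sum]
            refine Finset.sum_eq_zero fun m hm => ?_
            rw [map_zsmul, h.apply_of_ne j m
              ((Finset.mem_range.1 hm).trans_le hjT).ne', smul_zero]
          rw [this, zero_add] at hxj
          exact hn.2 hxj.symm
      obtain ⟨i, rfl⟩ := hcne j hcj
      refine Finset.mem_image.2 ⟨i, Finset.mem_range.2 ?_, rfl⟩
      -- From `2 ^ (i + t + 1) ≤ J i < 2 ^ (n + 1)` follows `i < n`: fewer than `2 ^ n` terms can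
      -- reach the block.
      have := (Nat.pow_lt_pow_iff_right (a := 2) one_lt_two).1 ((hJ i).trans_lt hj.2)
      omega
    have hcard := (Finset.card_le_card hsub).trans Finset.card_image_le
    rw [Nat.card_Ico, Finset.card_range, pow_succ] at hcard
    have := Nat.lt_two_pow_self (n := n)
    omega

end IsCoordinateSystem

theorem IsCoordinateSystem.exists_complete_isMinAP {G : Type u} {R : Type*} [AddCommGroup G]
    [Countable G] [AddCommGroup R] {π : ℕ → G →+ R} {e : ℕ → G} {r : R}
    (h : IsCoordinateSystem π e r) (hG : AddMonoid.ExponentExists G) :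
    ∃ (_ : TopologicalSpace G) (_ : IsTopologicalAddGroup G),
      T2Space G ∧ IsMinAP G ∧ IsCompleteGroup G := by
  obtain ⟨g, hg, hgπ⟩ := h.exists_enumeration
  have hA := isSymmChain_signedTail e (shifted e g)
  refine ⟨hA.topology, hA.isTopologicalAddGroup, hA.t2Space fun x hx => ?_,
    hA.isMinAP (closure_signedTail hg) hG,
    hA.isCompleteGroup (finite_signedTail_diff _ _) (closure_signedTail hg 0)⟩
  obtain ⟨t, ht⟩ := h.eventually_zero x
  exact ⟨_, h.notMem_sumSet hgπ ht hx⟩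

/-! ### Prüfer's theorem for groups killed by a prime power -/

theorem ZMod.exists_eq_nsmul_of_cast_eq_zero {p n : ℕ} [NeZero n] (x : ZMod n)
    (h : (x.val : ZMod p) = 0) : p • ((x.val / p : ℕ) : ZMod n) = x := by
  rw [nsmul_eq_mul, ← Nat.cast_mul, Nat.mul_div_cancel' ((ZMod.natCast_eq_zero_iff _ _).1 h),
    ZMod.natCast_zmod_val]

theorem exists_addEquiv_finsupp_zmod (p : ℕ) [Fact p.Prime] (V : Type u) [AddCommGroup V]
    (hV : ∀ x : V, p • x = 0) : ∃ K : Type u, Nonempty (V ≃+ (K →₀ ZMod p)) := by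
  let _ : Module (ZMod p) V := AddCommGroup.zmodModule hV
  exact ⟨_, ⟨(Module.Basis.ofVectorSpace (ZMod p) V).repr.toAddEquiv⟩⟩

/-- In a group killed by `p ^ (n + 1)`, a homocyclic subgroup of exponent `p ^ (n + 1)` having the
same image under multiplication by `p ^ n` as the whole group. -/
theorem exists_homocyclic_hom {G : Type u} [AddCommGroup G] {p : ℕ} (hp : p.Prime) (n : ℕ)
    (hG : ∀ x : G, p ^ (n + 1) • x = 0) :
    ∃ (K : Type u) (s : (K →₀ ZMod (p ^ (n + 1))) →+ G),
      (∀ c, p ^ n • s c = 0 → ∃ c', c = p • c') ∧ ∀ x, ∃ c, p ^ n • x = p ^ n • s c := by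
  have : Fact p.Prime := ⟨hp⟩
  have : NeZero (p ^ (n + 1)) := ⟨pow_ne_zero _ hp.ne_zero⟩
  let V : AddSubgroup G := (nsmulAddMonoidHom (α := G) (p ^ n)).range
  obtain ⟨K, ⟨b⟩⟩ := exists_addEquiv_finsupp_zmod p V fun x => by
    obtain ⟨_, y, rfl⟩ := x
    ext
    simp [← mul_smul, ← pow_succ', hG]
  have hlift : ∀ k, ∃ x : G, p ^ n • x = (b.symm (Finsupp.single k 1) : V) :=
    fun k => (b.symm (Finsupp.single k 1)).2
  choose x hx using hlift
  let s : (K →₀ ZMod (p ^ (n + 1))) →+ G :=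
    Finsupp.liftAddHom fun k => ZMod.lift (p ^ (n + 1)) ⟨zmultiplesHom G (x k), by
      rw [zmultiplesHom_apply, natCast_zsmul, hG]⟩
  have hs : ∀ k (m : ℕ), s (Finsupp.single k (m : ZMod (p ^ (n + 1)))) = m • x k := fun k m => by
    have h1 := ZMod.lift_coe (p ^ (n + 1)) ⟨zmultiplesHom G (x k), by
      rw [zmultiplesHom_apply, natCast_zsmul, hG]⟩ (m : ℤ)
    rw [Int.cast_natCast] at h1
    refine (Finsupp.liftAddHom_apply_single _ _ _).trans (h1.trans ?_)
    simp
  have hdvd : p ∣ p ^ (n + 1) := dvd_pow_self p n.succ_ne_zero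
  have key : ∀ c, b ⟨p ^ n • s c, s c, rfl⟩ =
      Finsupp.mapRange.addMonoidHom (ZMod.castHom hdvd (ZMod p)).toAddMonoidHom c := by
    let f : (K →₀ ZMod (p ^ (n + 1))) →+
        (K →₀ ZMod p) :=
      (b : V →+ _).comp ((nsmulAddMonoidHom (α := G) (p ^ n)).rangeRestrict.comp s)
    have hf : f =
        Finsupp.mapRange.addMonoidHom (ZMod.castHom hdvd (ZMod p)).toAddMonoidHom := by
      refine Finsupp.addHom_ext fun k y => ?_
      obtain ⟨m, rfl⟩ : ∃ m : ℕ, (m : ZMod (p ^ (n + 1))) = y := ⟨y.val, ZMod.natCast_zmod_val y⟩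
      have h1 : (nsmulAddMonoidHom (α := G) (p ^ n)).rangeRestrict
          (s (Finsupp.single k (m : ZMod (p ^ (n + 1))))) = m • b.symm (Finsupp.single k 1) := by
        ext
        simp only [AddMonoidHom.coe_rangeRestrict, hs, AddSubgroup.coe_nsmul, ← hx]
        exact smul_comm _ _ _
      have h2 : f (Finsupp.single k (m : ZMod (p ^ (n + 1)))) =
          b (m • b.symm (Finsupp.single k 1)) := by
        rw [← h1]
        rfl
      rw [h2, map_nsmul, b.apply_symm_apply]
      simp
    exact fun c => DFunLike.congr_fun hf c
  refine ⟨_, s, fun c hc => ?_, fun y => ?_⟩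
  · have h0 : Finsupp.mapRange.addMonoidHom (ZMod.castHom hdvd (ZMod p)).toAddMonoidHom c = 0 := by
      rw [← key, ← map_zero b]
      congr 1
      exact Subtype.ext hc
    refine ⟨c.mapRange (fun a => ((a.val / p : ℕ) : ZMod (p ^ (n + 1)))) (by simp), ?_⟩
    ext k
    have hk := DFunLike.congr_fun h0 k
    simp only [Finsupp.mapRange.addMonoidHom_apply, Finsupp.mapRange_apply, Finsupp.coe_zero,
      Pi.zero_apply] at hk
    rw [Finsupp.smul_apply, Finsupp.mapRange_apply, ZMod.exists_eq_nsmul_of_cast_eq_zero]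
    have hk' : ZMod.castHom hdvd (ZMod p) (c k) = 0 := hk
    rwa [← ZMod.natCast_zmod_val (c k), map_natCast] at hk'
  · let v : V := ⟨p ^ n • y, y, rfl⟩
    refine ⟨(b v).mapRange (fun a => (a.val : ZMod (p ^ (n + 1)))) (by simp), ?_⟩
    have : v = ⟨p ^ n • s _, s _, rfl⟩ := b.injective ((key
      ((b v).mapRange (fun a => (a.val : ZMod (p ^ (n + 1)))) (by simp))).trans ?_).symm
    · exact congrArg Subtype.val this
    · ext k
      simp

/-- An element of the kernel is divisible by `p` again and again, until it is a multiple of `p ^ (n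
+ 1)`. -/
theorem injective_of_homocyclic {G K : Type*} [AddCommGroup G] {p n : ℕ}
    (s : (K →₀ ZMod (p ^ (n + 1))) →+ G)
    (hs : ∀ c, p ^ n • s c = 0 → ∃ c', c = p • c') : Function.Injective s := by
  rw [injective_iff_map_eq_zero]
  intro c hc
  have key : ∀ j ≤ n + 1, ∃ c', c = p ^ j • c' := by
    intro j hj
    induction j with
    | zero => exact ⟨c, by simp⟩
    | succ j ih =>
      obtain ⟨c', rfl⟩ := ih (by omega)
      obtain ⟨c'', rfl⟩ := hs c' (by
        obtain ⟨i, rfl⟩ : ∃ i, n = i + j := ⟨n - j, by omega⟩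
        rw [pow_add, mul_smul, ← map_nsmul, hc, smul_zero])
      exact ⟨c'', (mul_smul (p ^ j) p c'').symm⟩
  obtain ⟨c', rfl⟩ := key _ le_rfl
  ext k
  simp

theorem exists_maximal_disjoint {G : Type*} [AddCommGroup G] (H : AddSubgroup G) :
    ∃ C : AddSubgroup G, Maximal (fun C => ∀ x ∈ C, x ∈ H → x = 0) C := by
  obtain ⟨C, -, hC⟩ := zorn_le_nonempty₀ {C : AddSubgroup G | ∀ x ∈ C, x ∈ H → x = 0}
    (fun c hc hch y hy => by
      refine ⟨sSup c, fun x hx hxH => ?_, fun z hz => le_sSup hz⟩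
      obtain ⟨D, hD, hxD⟩ := (AddSubgroup.mem_sSup_of_directedOn ⟨y, hy⟩ hch.directedOn).1 hx
      exact hc hD x hxD hxH)
    ⊥ (fun x hx _ => by simpa using hx)
  exact ⟨C, hC⟩

/-- A subgroup `C` maximal among those meeting the range of `s` trivially is a complement: `s.range
⊔ C` is closed under division by `p`, hence everything. The retraction is the projection along `C`.
-/
theorem exists_retraction {G K : Type*} [AddCommGroup G] {p n : ℕ} (hp : p.Prime)
    (hG : ∀ x : G, p ^ (n + 1) • x = 0) (s : (K →₀ ZMod (p ^ (n + 1))) →+ G)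
    (hs : ∀ c, p ^ n • s c = 0 → ∃ c', c = p • c') :
    ∃ φ : G →+ (K →₀ ZMod (p ^ (n + 1))), ∀ c, φ (s c) = c := by
  have hinj := injective_of_homocyclic s hs
  obtain ⟨C, hC⟩ := exists_maximal_disjoint s.range
  have hdis : ∀ c, s c ∈ C → c = 0 := fun c hc =>
    (injective_iff_map_eq_zero s).1 hinj c (hC.prop _ hc ⟨c, rfl⟩)
  have hstep : ∀ y, p • y ∈ C → y ∈ s.range ⊔ C := by
    intro y hy
    by_contra hy'
    have hnot : ¬ ∀ x ∈ C ⊔ AddSubgroup.zmultiples y, x ∈ s.range → x = 0 := fun hall =>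
      hy' (AddSubgroup.mem_sup_right (hC.le_of_ge hall le_sup_left
        (AddSubgroup.mem_sup_right (AddSubgroup.mem_zmultiples y))))
    push Not at hnot
    obtain ⟨h, hh, hhs, hne⟩ := hnot
    obtain ⟨a, ha, _, ⟨m, rfl⟩, rfl⟩ := AddSubgroup.mem_sup.1 hh
    by_cases hpm : (p : ℤ) ∣ m
    · obtain ⟨m', rfl⟩ := hpm
      refine hne (hC.prop _ (add_mem ha ?_) hhs)
      simp only
      rw [mul_comm, mul_smul, natCast_zsmul]
      exact zsmul_mem hy m'
    -- By Bézout, `y` is a combination of `a + m • y`, `p • y` and `a`, all of which lie in the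
    -- range or in `C`.
    · obtain ⟨a', b', hab⟩ := (Nat.prime_iff_prime_int.1 hp).coprime_iff_not_dvd.2 hpm
      refine hy' ?_
      change a + m • y ∈ s.range at hhs
      have : y = b' • (a + m • y) + (a' • (p • y) - b' • a) := by
        rw [← natCast_zsmul y p]
        conv_lhs => rw [← one_smul ℤ y, ← hab]
        rw [add_smul, mul_smul, mul_smul, smul_add]
        abel
      rw [this]
      exact AddSubgroup.add_mem_sup (zsmul_mem hhs _) (sub_mem (zsmul_mem hy _) (zsmul_mem ha _))
  have hstep' : ∀ x, p • x ∈ s.range ⊔ C → x ∈ s.range ⊔ C := by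
    intro x hx
    obtain ⟨_, ⟨c, rfl⟩, a, ha, hca⟩ := AddSubgroup.mem_sup.1 hx
    have h1 : p ^ n • s c + p ^ n • a = 0 := by
      rw [← smul_add, hca, ← mul_smul, ← pow_succ, hG]
    -- Here `p ^ n • s c` lies in both the range and `C`. Thus `c` is divisible by `p`, and
    -- subtracting `s c'` from `x` leaves an element whose `p`-multiple is in `C`.
    have h2 : p ^ n • c = 0 := by
      refine hdis _ ?_
      rw [map_nsmul, eq_neg_of_add_eq_zero_left h1]
      exact neg_mem (nsmul_mem ha _)
    obtain ⟨c', rfl⟩ := hs c (by rw [← map_nsmul, h2, map_zero])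
    have h3 : x - s c' ∈ s.range ⊔ C := hstep _ (by
      rw [smul_sub, ← hca, map_nsmul]
      simpa using ha)
    have := add_mem h3 (AddSubgroup.mem_sup_left (T := C) (⟨c', rfl⟩ : s c' ∈ s.range))
    rwa [sub_add_cancel] at this
  have htop : ∀ x, x ∈ s.range ⊔ C := by
    have : ∀ j, ∀ x, p ^ j • x ∈ s.range ⊔ C → x ∈ s.range ⊔ C := by
      intro j
      induction j with
      | zero => simp
      | succ j ih => exact fun x hx => hstep' x (ih _ (by rwa [← mul_smul, ← pow_succ]))
    exact fun x => this (n + 1) x (by rw [hG]; exact zero_mem _)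
  have hex : ∀ x, ∃ c, x - s c ∈ C := fun x => by
    obtain ⟨_, ⟨c, rfl⟩, a, ha, rfl⟩ := AddSubgroup.mem_sup.1 (htop x)
    exact ⟨c, by simpa using ha⟩
  choose φ hφ using hex
  have huniq : ∀ x c, x - s c ∈ C → φ x = c := fun x c hc => by
    refine sub_eq_zero.1 (hdis _ ?_)
    have := sub_mem hc (hφ x)
    rwa [sub_sub_sub_cancel_left, ← map_sub] at this
  refine ⟨AddMonoidHom.mk' φ fun x y => huniq _ _ ?_, fun c => huniq _ _ (by simp)⟩
  rw [map_add, add_sub_add_comm]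
  exact add_mem (hφ x) (hφ y)

/-- Prüfer's theorem for groups killed by `p ^ n`, in terms of the component projections. -/
theorem exists_pPrimary_components {p : ℕ} (hp : p.Prime) (n : ℕ) {G : Type u} [AddCommGroup G]
    (hG : ∀ x : G, p ^ n • x = 0) :
    ∃ F : (i : ℕ) → Σ κ : Type u, G →+ (κ →₀ ZMod (p ^ i)),
      (∀ g, (∀ i ∈ Finset.Icc 1 n, (F i).2 g = 0) → g = 0) ∧
      ∀ y : (i : ℕ) → ((F i).1 →₀ ZMod (p ^ i)), ∃ g, ∀ i ∈ Finset.Icc 1 n, (F i).2 g = y i := by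
  induction n generalizing G with
  | zero =>
    exact ⟨fun i => ⟨PEmpty, 0⟩, fun g _ => by simpa using hG g, fun y => ⟨0, by simp⟩⟩
  | succ n ih =>
    obtain ⟨K, s, hs, hs'⟩ := exists_homocyclic_hom hp n hG
    obtain ⟨φ, hφ⟩ := exists_retraction hp hG s hs
    -- The kernel of the retraction is killed by `p ^ n`, because `p ^ n • G` lies in the range of
    -- `s`.
    obtain ⟨F, hF, hF'⟩ := ih (G := φ.ker) (by
      rintro ⟨x, hx⟩
      ext
      obtain ⟨c, hc⟩ := hs' x
      have h0 : p ^ n • c = 0 := by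
        rw [← hφ (p ^ n • c), map_nsmul s, ← hc, map_nsmul, show φ x = 0 from hx, smul_zero]
      rw [AddSubgroup.coe_nsmul, hc, ← map_nsmul, h0, map_zero]
      rfl)
    let q : G →+ φ.ker := ((AddMonoidHom.id G) - s.comp φ).codRestrict φ.ker fun g => by
      simp [AddMonoidHom.mem_ker, hφ]
    have hq : ∀ g, (q g : G) = g - s (φ g) := fun g => rfl
    let X : Σ κ : Type u, G →+ (κ →₀ ZMod (p ^ (n + 1))) := ⟨K, φ⟩
    let E : (i : ℕ) → Σ κ : Type u, G →+ (κ →₀ ZMod (p ^ i)) :=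
      Function.update (fun i => ⟨(F i).1, (F i).2.comp q⟩) (n + 1) X
    have hE : E (n + 1) = X := Function.update_self _ _ _
    have hE' : ∀ i, i ≠ n + 1 → E i = ⟨(F i).1, (F i).2.comp q⟩ := fun i hi =>
      Function.update_of_ne hi _ _
    refine ⟨E, fun g hg => ?_, fun y => ?_⟩
    · have h1 : φ g = 0 := by
        have := hg (n + 1) (by simp)
        rwa [hE] at this
      have h2 : q g = 0 := hF _ fun i hi => by
        rw [Finset.mem_Icc] at hi
        have := hg i (by rw [Finset.mem_Icc]; omega)
        rwa [hE' i (by omega)] at this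
      have h3 := congrArg Subtype.val h2
      rw [hq, h1, map_zero, sub_zero] at h3
      exact h3
    -- Transport along an equality of pairs, since the codomain of `(E i).2` depends on `E i`.
    · have aux : ∀ (i : ℕ) (Y Z : Σ κ : Type u, G →+ (κ →₀ ZMod (p ^ i))), Y = Z →
          ∀ y : Y.1 →₀ ZMod (p ^ i), ∃ z : Z.1 →₀ ZMod (p ^ i), ∀ g, Z.2 g = z → Y.2 g = y := by
        rintro i Y _ rfl y
        exact ⟨y, fun _ h => h⟩
      obtain ⟨c, hc⟩ := aux _ _ _ hE (y (n + 1))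
      have hz : ∀ i, ∃ z : (F i).1 →₀ ZMod (p ^ i),
          i ≠ n + 1 → ∀ g, (F i).2 (q g) = z → (E i).2 g = y i := by
        intro i
        by_cases hi : i = n + 1
        · exact ⟨0, fun h => absurd hi h⟩
        · obtain ⟨z, hz⟩ := aux _ _ _ (hE' i hi) (y i)
          exact ⟨z, fun _ => hz⟩
      choose z hz using hz
      obtain ⟨k, hk⟩ := hF' z
      have hφg : φ (s c + k) = c := by
        rw [map_add, hφ, show φ (k : G) = 0 from k.2, add_zero]
      refine ⟨s c + k, fun i hi => ?_⟩
      by_cases hin : i = n + 1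
      · subst hin
        exact hc _ hφg
      · refine hz i hin _ ?_
        have : q (s c + k) = k := by
          ext
          rw [hq, hφg]
          abel
        rw [this]
        refine hk i ?_
        rw [Finset.mem_Icc] at hi ⊢
        omega

/-! ### Prüfer's theorem for bounded groups -/

theorem nsmul_finsupp_zmod_eq_zero {K : Type*} {d m : ℕ} (h : d ∣ m) (y : K →₀ ZMod d) :
    m • y = 0 := by
  ext k
  rw [Finsupp.smul_apply, nsmul_eq_mul, (ZMod.natCast_eq_zero_iff m d).2 h, zero_mul]
  rfl

theorem nsmul_eq_of_modEq {G : Type*} [AddCommGroup G] {d m m' : ℕ} (h : m ≡ m' [MOD d]) {x : G}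
    (hx : d • x = 0) : m • x = m' • x :=
  nsmul_eq_nsmul_iff_modEq.2 (h.of_dvd (addOrderOf_dvd_of_nsmul_eq_zero hx))

/-- A finite iterated direct sum is the iterated product. -/
noncomputable def directSumEquivPi (M : Finset ℕ) (n : ℕ → ℕ)
    (X : (p : M) → Finset.Icc 1 (n p) → Type*) [∀ p i, AddCommMonoid (X p i)] :
    (⨁ p : M, ⨁ i : Finset.Icc 1 (n p), X p i) ≃+ ∀ p i, X p i :=
  (DirectSum.addEquivProd _).trans (AddEquiv.piCongrRight fun _ => DirectSum.addEquivProd _)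

/-- On a group killed by `N`, multiplication by `a p` is the projection onto the `p`-primary part.
-/
theorem Nat.exists_idempotents (N : ℕ) :
    ∃ a : ℕ → ℕ, ∀ p ∈ N.primeFactors, ∀ q ∈ N.primeFactors,
      a p ≡ (if q = p then 1 else 0) [MOD q ^ N.factorization q] := by
  have : ∀ p, ∃ a, ∀ q ∈ N.primeFactors,
      a ≡ (if q = p then 1 else 0) [MOD q ^ N.factorization q] := fun p => by
    obtain ⟨a, ha⟩ := Nat.chineseRemainderOfFinset (fun q => if q = p then 1 else 0)
      (fun q => q ^ N.factorization q) N.primeFactors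
      (fun q hq => pow_ne_zero _ (Nat.prime_of_mem_primeFactors hq).ne_zero)
      (fun q hq q' hq' hne => Nat.Coprime.pow _ _ ((Nat.coprime_primes
        (Nat.prime_of_mem_primeFactors hq) (Nat.prime_of_mem_primeFactors hq')).2 hne))
    exact ⟨a, ha⟩
  choose a ha using this
  exact ⟨a, fun p _ q hq => ha p q hq⟩

theorem Nat.dvd_of_forall_primeFactors {N z : ℕ} (hN : N ≠ 0)
    (h : ∀ q ∈ N.primeFactors, q ^ N.factorization q ∣ z) : N ∣ z := by
  rw [Nat.dvd_iff_prime_pow_dvd_dvd]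
  intro p k hp hk
  rcases k.eq_zero_or_pos with rfl | hk0
  · simp
  · exact (pow_dvd_pow p ((hp.pow_dvd_iff_le_factorization hN).1 hk)).trans
      (h p (Nat.mem_primeFactors.2 ⟨hp, (dvd_pow_self p hk0.ne').trans hk, hN⟩))

/-- Thus `N / p` kills every cyclic component except those of order `p ^ N.factorization p`. -/
theorem Nat.pow_dvd_div_of_mem_primeFactors {N p q i : ℕ} (hp : p ∈ N.primeFactors)
    (hq : q ∈ N.primeFactors) (hi : i ≤ N.factorization q)
    (h : q = p → i ≠ N.factorization p) : q ^ i ∣ N / p := by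
  have hp' := Nat.prime_of_mem_primeFactors hp
  have hq' := Nat.prime_of_mem_primeFactors hq
  have hN : p * (N / p) = N := Nat.mul_div_cancel' (Nat.dvd_of_mem_primeFactors hp)
  by_cases hqp : q = p
  · subst hqp
    refine Nat.dvd_of_mul_dvd_mul_left hp'.pos ?_
    rw [hN, ← pow_succ']
    exact (pow_dvd_pow q (by have := h rfl; omega)).trans (Nat.ordProj_dvd N q)
  · refine (Nat.Coprime.pow_left i ((Nat.coprime_primes hq' hp').2 hqp)).dvd_of_dvd_mul_left ?_
    rw [hN]
    exact (pow_dvd_pow q hi).trans (Nat.ordProj_dvd N q)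

/-- Prüfer's theorem, in terms of the component projections. -/
theorem exists_components (G : Type u) [AddCommGroup G] {N : ℕ} (hN0 : N ≠ 0)
    (hN : ∀ x : G, N • x = 0) :
    ∃ F : (p i : ℕ) → Σ κ : Type u, G →+ (κ →₀ ZMod (p ^ i)),
      (∀ g, (∀ p ∈ N.primeFactors, ∀ i ∈ Finset.Icc 1 (N.factorization p), (F p i).2 g = 0) →
        g = 0) ∧
      ∀ y : (p i : ℕ) → ((F p i).1 →₀ ZMod (p ^ i)), ∃ g, ∀ p ∈ N.primeFactors,
        ∀ i ∈ Finset.Icc 1 (N.factorization p), (F p i).2 g = y p i := by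
  obtain ⟨a, ha⟩ := N.exists_idempotents
  let T : ℕ → AddSubgroup G := fun p => (nsmulAddMonoidHom (α := G) (p ^ N.factorization p)).ker
  have hT : ∀ p (x : T p), p ^ N.factorization p • (x : G) = 0 := fun p x => x.2
  have hmem : ∀ p ∈ N.primeFactors, ∀ g : G, a p • g ∈ T p := by
    intro p hp g
    change p ^ N.factorization p • a p • g = 0
    have hdvd : N ∣ p ^ N.factorization p * a p := by
      refine Nat.dvd_of_forall_primeFactors hN0 fun q hq => ?_
      by_cases hqp : q = p
      · exact hqp ▸ dvd_mul_right _ _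
      · have := ha p hp q hq
        rw [if_neg hqp, Nat.modEq_zero_iff_dvd] at this
        exact this.mul_left _
    obtain ⟨b, hb⟩ := hdvd
    rw [← mul_smul, hb, mul_smul, hN]
  have hF : ∀ p, ∃ F : (i : ℕ) → Σ κ : Type u, T p →+ (κ →₀ ZMod (p ^ i)),
      p ∈ N.primeFactors →
      (∀ g, (∀ i ∈ Finset.Icc 1 (N.factorization p), (F i).2 g = 0) → g = 0) ∧
      ∀ y : (i : ℕ) → ((F i).1 →₀ ZMod (p ^ i)), ∃ g,
        ∀ i ∈ Finset.Icc 1 (N.factorization p), (F i).2 g = y i := by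
    intro p
    by_cases hp : p ∈ N.primeFactors
    · obtain ⟨F, hF⟩ := exists_pPrimary_components (Nat.prime_of_mem_primeFactors hp)
        (N.factorization p) (G := T p) fun x => Subtype.ext (hT p x)
      exact ⟨F, fun _ => hF⟩
    · exact ⟨fun i => ⟨PEmpty, 0⟩, fun h => absurd h hp⟩
  choose F hF using hF
  have hq : ∀ p, ∃ q : G →+ T p, p ∈ N.primeFactors → ∀ g, (q g : G) = a p • g := by
    intro p
    by_cases hp : p ∈ N.primeFactors
    · exact ⟨(nsmulAddMonoidHom (α := G) (a p)).codRestrict (T p) (hmem p hp), fun _ _ => rfl⟩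
    · exact ⟨0, fun h => absurd h hp⟩
  choose q hq using hq
  refine ⟨fun p i => ⟨(F p i).1, (F p i).2.comp (q p)⟩, fun g hg => ?_, fun y => ?_⟩
  · rw [← AddMonoid.addOrderOf_eq_one_iff, Nat.eq_one_iff_not_exists_prime_dvd]
    intro p hp hpd
    have hpN : p ∈ N.primeFactors := Nat.mem_primeFactors.2
      ⟨hp, hpd.trans (addOrderOf_dvd_of_nsmul_eq_zero (hN g)), hN0⟩
    have h1 : a p • g = 0 := by
      rw [← hq p hpN, (hF p hpN).1 (q p g) (hg p hpN)]
      rfl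
    have h2 : p ∣ a p := hpd.trans (addOrderOf_dvd_of_nsmul_eq_zero h1)
    have h3 := ha p hpN p hpN
    rw [if_pos rfl] at h3
    have h4 := (h3.of_dvd (dvd_pow_self p
      (hp.factorization_pos_of_dvd hN0 (Nat.dvd_of_mem_primeFactors hpN)).ne')).symm.trans
      ((Nat.modEq_zero_iff_dvd).2 h2)
    exact hp.one_lt.ne' (Nat.dvd_one.1 ((Nat.modEq_zero_iff_dvd).1 h4))
  · have hex : ∀ p, ∃ g : T p, p ∈ N.primeFactors →
        ∀ i ∈ Finset.Icc 1 (N.factorization p), (F p i).2 g = y p i := by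
      intro p
      by_cases hp : p ∈ N.primeFactors
      · obtain ⟨g, hg⟩ := (hF p hp).2 (y p)
        exact ⟨g, fun _ => hg⟩
      · exact ⟨0, fun h => absurd h hp⟩
    choose g hg using hex
    refine ⟨∑ p ∈ N.primeFactors, (g p : G), fun p hp i hi => ?_⟩
    rw [← hg p hp i hi]
    change (F p i).2 (q p _) = _
    congr 1
    ext
    rw [hq p hp, Finset.smul_sum, Finset.sum_eq_single_of_mem p hp]
    · rw [nsmul_eq_of_modEq (ha p hp p hp) (hT p (g p)), if_pos rfl, one_smul]
    · intro p' hp' hne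
      rw [nsmul_eq_of_modEq (ha p hp p' hp') (hT p' (g p')), if_neg hne, zero_smul]

theorem nonempty_cyclicDecomposition (G : Type u) [AddCommGroup G]
    (hG : AddMonoid.ExponentExists G) : Nonempty (CyclicDecomposition G) := by
  have hN0 := AddMonoid.exponent_ne_zero.2 hG
  obtain ⟨F, hF, hF'⟩ := exists_components G hN0 fun x => AddMonoid.exponent_nsmul_eq_zero x
  set N := AddMonoid.exponent G with hN
  let ι (p i : ℕ) : ((F p i).1 →₀ ZMod (p ^ i)) ≃+
      ((Cardinal.mk (F p i).1).out →₀ ZMod (p ^ i)) := Finsupp.domCongr Cardinal.outMkEquiv.symm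
  let f : G →+ ∀ (p : N.primeFactors) (i : Finset.Icc 1 (N.factorization p)),
      ((Cardinal.mk (F p i).1).out →₀ ZMod ((p : ℕ) ^ (i : ℕ))) :=
    AddMonoidHom.pi fun p => AddMonoidHom.pi fun i => (ι p i : _ →+ _).comp (F p i).2
  have hf : ∀ g p i, f g p i = ι p i ((F p i).2 g) := fun _ _ _ => rfl
  have hbij : Function.Bijective f := by
    constructor
    · rw [injective_iff_map_eq_zero]
      intro g hg
      refine hF g fun p hp i hi => (ι p i).injective ?_
      rw [map_zero, ← hf g ⟨p, hp⟩ ⟨i, hi⟩, hg]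
      rfl
    · intro y
      obtain ⟨g, hg⟩ := hF' fun p i =>
        if h : p ∈ N.primeFactors ∧ i ∈ Finset.Icc 1 (N.factorization p) then
          (ι p i).symm (y ⟨p, h.1⟩ ⟨i, h.2⟩) else 0
      refine ⟨g, funext fun p => funext fun i => ?_⟩
      rw [hf, hg p p.2 i i.2, dif_pos ⟨p.2, i.2⟩, AddEquiv.apply_symm_apply]
  refine ⟨{
    M := N.primeFactors
    prime_of_mem := fun p hp => Nat.prime_of_mem_primeFactors hp
    n := N.factorization
    one_le_n := fun p hp => (Nat.prime_of_mem_primeFactors hp).factorization_pos_of_dvd hN0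
      (Nat.dvd_of_mem_primeFactors hp)
    k := fun i p => Cardinal.mk (F p i).1
    k_ne_zero := fun p hp h0 => ?_
    iso := (AddEquiv.ofBijective f hbij).trans (directSumEquivPi _ _ _).symm }⟩
  -- Were there no component of top exponent at `p`, already `N / p` would kill `G`, against `N`
  -- being the exponent.
  have : IsEmpty (F p (N.factorization p)).1 := Cardinal.mk_eq_zero_iff.1 h0
  have hp' := Nat.prime_of_mem_primeFactors hp
  have hdvd : N ∣ N / p := AddMonoid.exponent_dvd_of_forall_nsmul_eq_zero fun g =>
    hF _ fun q hq i hi => by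
      rw [map_nsmul]
      by_cases h : q = p ∧ i = N.factorization p
      · obtain ⟨rfl, rfl⟩ := h
        exact Subsingleton.elim _ _
      · exact nsmul_finsupp_zmod_eq_zero (Nat.pow_dvd_div_of_mem_primeFactors hp hq
          (Finset.mem_Icc.1 hi).2 fun h1 h2 => h ⟨h1, h1 ▸ h2⟩) _
  have hpos : 0 < N / p := Nat.div_pos (Nat.le_of_mem_primeFactors hp) hp'.pos
  exact absurd (Nat.le_of_dvd hpos hdvd)
    (not_le.2 (Nat.div_lt_self (Nat.pos_of_ne_zero hN0) hp'.one_lt))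

/-! ### Consequences of a decomposition -/

namespace CyclicDecomposition

variable {G : Type u} [AddCommGroup G] (D : CyclicDecomposition G)

/-- The components of a decomposition, as an isomorphism onto a product. -/
noncomputable def components : G ≃+ ∀ (p : D.M) (i : Finset.Icc 1 (D.n p)),
    ((D.k (i : ℕ) (p : ℕ)).out →₀ ZMod ((p : ℕ) ^ (i : ℕ))) :=
  D.iso.trans (directSumEquivPi _ _ _)

/-- The largest exponent, as an index. -/
def top (p : D.M) : Finset.Icc 1 (D.n p) :=
  ⟨D.n p, Finset.mem_Icc.2 ⟨D.one_le_n p p.2, le_rfl⟩⟩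

/-- The projection onto the component of largest exponent. -/
noncomputable def topComponent (p : D.M) :
    G →+ ((D.k (D.n p) (p : ℕ)).out →₀ ZMod ((p : ℕ) ^ D.n p)) :=
  (Pi.evalAddMonoidHom _ (D.top p)).comp ((Pi.evalAddMonoidHom _ p).comp D.components.toAddMonoidHom)

theorem topComponent_apply (p : D.M) (g : G) :
    D.topComponent p g = D.components g p (D.top p) := rfl

theorem exists_topComponent_eq
    (y : ∀ p : D.M, ((D.k (D.n p) (p : ℕ)).out →₀ ZMod ((p : ℕ) ^ D.n p))) :
    ∃ g, ∀ p, D.topComponent p g = y p := by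
  classical
  refine ⟨D.components.symm fun p => Pi.single (D.top p) (y p), fun p => ?_⟩
  rw [topComponent_apply, AddEquiv.apply_symm_apply]
  exact Pi.single_eq_same _ _

/-- The coordinates run simultaneously over all primes: `π j` reads place `η p j` of each top
component. An integer killing `1` is divisible by every `p ^ D.n p`, hence kills all of `G`. -/
theorem isCoordinateSystem (η : ∀ p : D.M, ℕ ↪ (D.k (D.n p) (p : ℕ)).out) :
    ∃ (π : ℕ → G →+ (∀ p : D.M, ZMod ((p : ℕ) ^ D.n p))) (e : ℕ → G),
      IsCoordinateSystem π e 1 := by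
  have he := fun j => D.exists_topComponent_eq fun p => Finsupp.single (η p j) 1
  choose e he using he
  refine ⟨fun j => AddMonoidHom.pi fun p => (Finsupp.applyAddHom (η p j)).comp (D.topComponent p),
    e, ⟨fun g => ?_, fun j => ?_, fun i j hij => ?_, fun z hz g => ?_⟩⟩
  · have : ∀ p : D.M, ∃ t, ∀ j, t ≤ j → D.topComponent p g (η p j) = 0 := fun p => by
      obtain ⟨t, ht⟩ := ((D.topComponent p g).support.finite_toSet.preimage
        (η p).injective.injOn).bddAbove
      refine ⟨t + 1, fun j hj => by_contra fun hne => ?_⟩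
      have := ht (show j ∈ _ from Finsupp.mem_support_iff.2 hne)
      omega
    choose t ht using this
    exact ⟨Finset.univ.sup t, fun j hj => funext fun p =>
      ht p j ((Finset.le_sup (Finset.mem_univ p)).trans hj)⟩
  · funext p
    change D.topComponent p (e j) (η p j) = 1
    rw [he, Finsupp.single_eq_same]
  · funext p
    change D.topComponent p (e j) (η p i) = 0
    rw [he, Finsupp.single_eq_of_ne ((η p).injective.ne hij)]
  · refine D.components.injective ?_
    rw [map_zero, map_zsmul]
    funext p i
    have hzp : ((z : ℤ) : ZMod ((p : ℕ) ^ D.n p)) = 0 := by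
      have := congrFun hz p
      simpa using this
    rw [ZMod.intCast_zmod_eq_zero_iff_dvd] at hzp
    have hdvd : (((p : ℕ) ^ (i : ℕ) : ℕ) : ℤ) ∣ z :=
      (Int.natCast_dvd_natCast.2 (pow_dvd_pow _ (Finset.mem_Icc.1 i.2).2)).trans hzp
    change z • D.components g p i = 0
    ext k
    rw [Finsupp.smul_apply, zsmul_eq_mul, (ZMod.intCast_zmod_eq_zero_iff_dvd _ _).2 hdvd, zero_mul]
    rfl

/-- Take `m = p ^ (n_p - 1)` times the other `q ^ n_q`. It kills every component but the top one at
`p`, which is finite and on which it is nonzero. -/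
theorem exists_nsmul_range_finite {p : ℕ} (hp : p ∈ D.M)
    (hk : D.k (D.n p) p < Cardinal.aleph0) :
    ∃ m : ℕ, Finite (nsmulAddMonoidHom (α := G) m).range ∧ ∃ g : G, m • g ≠ 0 := by
  have hpp := D.prime_of_mem p hp
  have hn := D.one_le_n p hp
  have : NeZero (p ^ D.n p) := ⟨pow_ne_zero _ hpp.ne_zero⟩
  set P := ∏ q ∈ D.M.erase p, q ^ D.n q with hP
  refine ⟨p ^ (D.n p - 1) * P, ?_, ?_⟩
  · have : Finite (D.k (D.n p) p).out := by
      rw [← Cardinal.lt_aleph0_iff_finite, Cardinal.mk_out]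
      exact hk
    have : Finite ((D.k (D.n p) p).out →₀ ZMod (p ^ D.n p)) :=
      Finite.of_injective _ DFunLike.coe_injective
    refine Finite.of_injective ((D.topComponent ⟨p, hp⟩).comp (AddSubgroup.subtype _))
      ((injective_iff_map_eq_zero _).2 ?_)
    rintro ⟨_, g, rfl⟩ h0
    refine Subtype.ext (D.components.injective ?_)
    change D.components ((p ^ (D.n p - 1) * P) • g) = D.components 0
    rw [map_zero]
    funext q i
    by_cases hqi : q = ⟨p, hp⟩ ∧ (i : ℕ) = D.n p
    · obtain ⟨rfl, hi⟩ := hqi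
      obtain rfl : i = D.top ⟨p, hp⟩ := Subtype.ext hi
      exact h0
    · rw [map_nsmul]
      refine nsmul_finsupp_zmod_eq_zero ?_ (D.components g q i)
      have hi := (Finset.mem_Icc.1 i.2).2
      by_cases hq : q = ⟨p, hp⟩
      · subst hq
        have hi' : (i : ℕ) ≠ D.n p := fun h => hqi ⟨rfl, h⟩
        refine (pow_dvd_pow p ?_).mul_right _
        change (i : ℕ) ≤ D.n p at hi
        omega
      · refine ((pow_dvd_pow _ hi).trans ?_).mul_left _
        exact Finset.dvd_prod_of_mem (fun q => q ^ D.n q)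
          (Finset.mem_erase.2 ⟨fun h => hq (Subtype.ext h), q.2⟩)
  · obtain ⟨k⟩ : Nonempty (D.k (D.n p) p).out := by
      rw [← Cardinal.mk_ne_zero_iff, Cardinal.mk_out]
      exact D.k_ne_zero p hp
    classical
    obtain ⟨g, hg⟩ := D.exists_topComponent_eq
      (Pi.single ⟨p, hp⟩ (Finsupp.single k 1))
    have hg' := hg ⟨p, hp⟩
    rw [Pi.single_eq_same] at hg'
    refine ⟨g, fun h0 => ?_⟩
    have h1 := congrArg (D.topComponent ⟨p, hp⟩) h0
    rw [map_nsmul, hg', map_zero] at h1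
    have h2 := DFunLike.congr_fun h1 k
    rw [Finsupp.smul_apply, Finsupp.single_eq_same, nsmul_one, Finsupp.coe_zero, Pi.zero_apply,
      ZMod.natCast_eq_zero_iff] at h2
    have h3 : p ^ (D.n p - 1) * p ∣ p ^ (D.n p - 1) * P := by
      rwa [← pow_succ, Nat.sub_add_cancel hn]
    have h4 := Nat.dvd_of_mul_dvd_mul_left (pow_pos hpp.pos _) h3
    obtain ⟨q, hq, hpq⟩ := (hpp.prime.dvd_finsetProd_iff _).1 h4
    rw [Finset.mem_erase] at hq
    exact hq.1 ((Nat.prime_dvd_prime_iff_eq hpp (D.prime_of_mem q hq.2)).1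
      (hpp.dvd_of_dvd_pow hpq)).symm

end CyclicDecomposition

/-! ### Necessity and conclusion -/

theorem IsMinAP.apply_eq_one {X : Type u} [AddCommGroup X] [TopologicalSpace X] (h : IsMinAP X)
    {χ : AddChar X Circle} (hχ : Continuous χ) (x : X) : χ x = 1 := by
  have hx : x ∈ vonNeumannRadical X := h ▸ AddSubgroup.mem_top x
  exact AddSubgroup.mem_iInf.1 hx ⟨χ, hχ⟩

/-- The finite Hausdorff group `m • G` is discrete, so all its characters pull back to continuous
ones of `G`; characters of a finite Abelian group separate points. -/
theorem IsMinAP.nsmul_eq_zero {G : Type u} [AddCommGroup G] [TopologicalSpace G]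
    [IsTopologicalAddGroup G] [T2Space G] (h : IsMinAP G) {m : ℕ}
    (hm : Finite (nsmulAddMonoidHom (α := G) m).range) (g : G) : m • g = 0 := by
  by_contra hne
  let f := (nsmulAddMonoidHom (α := G) m).rangeRestrict
  have hfg : f g ≠ 0 := fun h0 => hne (congrArg Subtype.val h0)
  obtain ⟨ψ, hψ⟩ := AddChar.exists_apply_ne_zero.2 hfg
  have hf : Continuous f := (continuous_nsmul m).subtype_mk _
  have hχ : Continuous ((AddChar.circleEquivComplex.symm ψ).compAddMonoidHom f) :=
    (continuous_of_discreteTopology (f := (AddChar.circleEquivComplex.symm ψ))).comp hf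
  have h1 : AddChar.circleEquivComplex.symm ψ (f g) = 1 := h.apply_eq_one hχ g
  refine hψ ?_
  rw [← AddChar.circleEquivComplex.apply_symm_apply ψ]
  exact congrArg ((↑) : Circle → ℂ) h1

theorem exists_complete_isMinAP_of_infinite (G : Type u) [AddCommGroup G] [Countable G]
    (hG : AddMonoid.ExponentExists G)
    (h : ∀ c : Cardinal.{u}, IsLeadingUlmKaplanskyInvariant G c → Cardinal.aleph0 ≤ c) :
    ∃ (_ : TopologicalSpace G) (_ : IsTopologicalAddGroup G),
      T2Space G ∧ IsMinAP G ∧ IsCompleteGroup G := by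
  obtain ⟨D⟩ := nonempty_cyclicDecomposition G hG
  have hinf : ∀ p : D.M, Infinite (D.k (D.n p) (p : ℕ)).out := fun p => by
    rw [Cardinal.infinite_iff, Cardinal.mk_out]
    exact h _ ⟨D, p, p.2, rfl⟩
  obtain ⟨π, e, hπ⟩ := D.isCoordinateSystem fun p => Infinite.natEmbedding _
  exact hπ.exists_complete_isMinAP hG

theorem corollary2 (G : Type u) [AddCommGroup G] [Countable G] [Infinite G]
    (hG : AddMonoid.ExponentExists G) :
    ((∃ _ : TopologicalSpace G, IsTopologicalAddGroup G ∧ T2Space G ∧ IsMinAP G) ↔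
      ∀ c : Cardinal.{u}, IsLeadingUlmKaplanskyInvariant G c → Cardinal.aleph0 ≤ c) ∧
    ((∀ c : Cardinal.{u}, IsLeadingUlmKaplanskyInvariant G c → Cardinal.aleph0 ≤ c) →
      ∃ (_ : TopologicalSpace G) (_ : IsTopologicalAddGroup G),
        T2Space G ∧ IsMinAP G ∧ IsCompleteGroup G) := by
  refine ⟨⟨?_, fun h => ?_⟩, exists_complete_isMinAP_of_infinite G hG⟩
  · rintro ⟨_, _, _, hmin⟩ _ ⟨D, p, hp, rfl⟩
    by_contra hlt
    obtain ⟨m, hm, g, hg⟩ := D.exists_nsmul_range_finite hp (not_le.1 hlt)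
    exact hg (hmin.nsmul_eq_zero hm g)
  · obtain ⟨τ, hτ, hT2, hmin, -⟩ := exists_complete_isMinAP_of_infinite G hG h
    exact ⟨τ, hτ, hT2, hmin⟩
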